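/- Let $R$ be a ring with unit (not necessarily commutative), let $R[z,z^{-1}]$ be the Laurent polynomial ring over $R$ in a central indeterminate $z$, and let $$R((z)) = \Big\{\sum_{i\ge k} r_i z^i \;\Big|\; k\in\mathbb Z,\ r_i\in R\Big\},\qquad R((z^{-1})) = \Big\{\sum_{i\le k} r_i z^i \;\Big|\; k\in\mathbb Z,\ r_i\in R\Big\}$$ be the two rings of formal Laurent series, each containing $R[z,z^{-1}]$ as a subring. Let $C$ be a bounded above cochain complex of projective right $R[z,z^{-1}]$-modules (bounded above means that $C^n=0$ for all sufficiently large $n$). Suppose that $C$ is finitely dominated, i.e. that $C$, considered as a cochain complex of right $R$-modules, is homotopy equivalent to a bounded cochain complex of finitely generated projective right $R$-modules. Then $C$ has trivial positive and negative Novikov cohomology, that is, the two cochain complexes $$C\otimes_{R[z,z^{-1}]} R((z)) \qquad\text{and}\qquad C\otimes_{R[z,z^{-1}]} R((z^{-1}))$$ are acyclic. -/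

import Mathlib

open CategoryTheory MulOpposite
open scoped LaurentPolynomial TensorProduct

universe u v w

noncomputable section

namespace Novikov

/-! Throughout, rings are unital and not necessarily commutative, and a right `A`-module is a
module over the opposite ring `Aᵐᵒᵖ`, with `m · a` written as `op a • m`. -/

section BaseChange

variable {A : Type u} {S : Type w} [Ring A] [Ring S] (f : A →+* S)

/-- For a ring homomorphism `f : A → S` and a right `A`-module `M`, the right `S`-submodule of
`S ⊗_ℤ M` (where `S` acts by right multiplication on the factor `S`) generated by the relations
`(f a * s) ⊗ m = s ⊗ (m · a)`. -/
def balancedRel (M : Type v) [AddCommGroup M] [Module Aᵐᵒᵖ M] : Submodule Sᵐᵒᵖ (S ⊗[ℤ] M) :=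
  Submodule.span Sᵐᵒᵖ
    {x | ∃ (a : A) (s : S) (m : M), x = (f a * s) ⊗ₜ[ℤ] m - s ⊗ₜ[ℤ] (op a • m)}

/-- The right `S`-module `M ⊗_A S`, for a right `A`-module `M` and a ring homomorphism
`f : A → S` through which `A` acts on `S` from the left. It is the quotient of the tensor product
over `ℤ` by the balancing relations `(m · a) ⊗ s = m ⊗ (f a * s)`; in the code the two tensor
factors are written in the other order. -/
abbrev BaseChange (M : Type v) [AddCommGroup M] [Module Aᵐᵒᵖ M] : Type (max v w) :=
  (S ⊗[ℤ] M) ⧸ balancedRel f M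

variable {M N P : Type v} [AddCommGroup M] [Module Aᵐᵒᵖ M] [AddCommGroup N] [Module Aᵐᵒᵖ N]
  [AddCommGroup P] [Module Aᵐᵒᵖ P]

/-- The map `id ⊗ g : S ⊗_ℤ M → S ⊗_ℤ N`, as a map of right `S`-modules. -/
def intTensorMap (g : M →ₗ[Aᵐᵒᵖ] N) : S ⊗[ℤ] M →ₗ[Sᵐᵒᵖ] S ⊗[ℤ] N :=
  TensorProduct.AlgebraTensorModule.map LinearMap.id (g.toAddMonoidHom.toIntLinearMap)

@[simp] lemma intTensorMap_tmul (g : M →ₗ[Aᵐᵒᵖ] N) (s : S) (m : M) :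
    intTensorMap g (s ⊗ₜ[ℤ] m) = s ⊗ₜ[ℤ] g m := rfl

lemma balancedRel_le_comap (g : M →ₗ[Aᵐᵒᵖ] N) :
    balancedRel f M ≤ (balancedRel f N).comap (intTensorMap g) := by
  refine Submodule.span_le.2 ?_
  rintro _ ⟨a, s, m, rfl⟩
  refine Submodule.subset_span ⟨a, s, g m, ?_⟩
  simp [map_sub]

/-- The map `g ⊗ id : M ⊗_A S → N ⊗_A S` induced by a map `g : M → N` of right `A`-modules. -/
def BaseChange.map (g : M →ₗ[Aᵐᵒᵖ] N) : BaseChange f M →ₗ[Sᵐᵒᵖ] BaseChange f N :=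
  (balancedRel f M).mapQ (balancedRel f N) (intTensorMap g) (balancedRel_le_comap f g)

/-- The pure tensor `m ⊗ s` in `M ⊗_A S`. -/
def BaseChange.tmul (m : M) (s : S) : BaseChange f M :=
  (balancedRel f M).mkQ (s ⊗ₜ[ℤ] m)

@[simp] lemma BaseChange.map_tmul (g : M →ₗ[Aᵐᵒᵖ] N) (m : M) (s : S) :
    BaseChange.map f g (BaseChange.tmul f m s) = BaseChange.tmul f (g m) s := rfl

lemma BaseChange.hom_ext {Q : Type*} [AddCommGroup Q] [Module Sᵐᵒᵖ Q]
    {g h : BaseChange f M →ₗ[Sᵐᵒᵖ] Q}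
    (H : ∀ m s, g (BaseChange.tmul f m s) = h (BaseChange.tmul f m s)) : g = h := by
  apply Submodule.linearMap_qext
  refine LinearMap.ext fun x => ?_
  induction x using TensorProduct.induction_on with
  | zero => simp
  | tmul s m => exact H m s
  | add x y hx hy => rw [map_add, map_add, hx, hy]

/-- The base change functor `- ⊗_A S` from right `A`-modules to right `S`-modules. -/
def baseChange : ModuleCat.{v} Aᵐᵒᵖ ⥤ ModuleCat.{max v w} Sᵐᵒᵖ where
  obj M := ModuleCat.of Sᵐᵒᵖ (BaseChange f M)
  map g := ModuleCat.ofHom (BaseChange.map f g.hom)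
  map_id M := by
    ext1
    exact BaseChange.hom_ext f fun _ _ => rfl
  map_comp g h := by
    ext1
    exact BaseChange.hom_ext f fun _ _ => rfl

instance : (baseChange.{u, v, w} f).Additive where
  map_add {M N g h} := by
    ext1
    refine BaseChange.hom_ext f fun m s => ?_
    change BaseChange.tmul f (g.hom m + h.hom m) s =
      BaseChange.tmul f (g.hom m) s + BaseChange.tmul f (h.hom m) s
    simp [BaseChange.tmul, TensorProduct.tmul_add]

end BaseChange

section NovikovRings

variable (R : Type u) [Ring R]

/-- The ring `R((z))` of formal Laurent series `∑_{i ≥ k} r_i z^i`: the functions `ℤ → R` whose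
support is well-ordered, that is, bounded below. The indeterminate is central. -/
abbrev PosRing : Type u := HahnSeries ℤ R

/-- The ring `R((z⁻¹))` of formal Laurent series `∑_{i ≤ k} r_i z^i`: the functions `ℤ → R` whose
support is well-ordered for the reversed order, that is, bounded above. -/
abbrev NegRing : Type u := HahnSeries ℤᵒᵈ R

/-- A homomorphism `e : ℤ → Γ` induces the ring homomorphism from Laurent polynomials to formal
series with exponents in `Γ` that sends `∑ r_i z^i` to `∑ r_i z^(e i)`. -/
def laurentToSeries {Γ : Type} [AddCommMonoid Γ] [PartialOrder Γ] [IsOrderedCancelAddMonoid Γ]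
    (e : ℤ →+ Γ) : R[T;T⁻¹] →+* HahnSeries Γ R :=
  AddMonoidAlgebra.liftNCRingHom HahnSeries.C
    { toFun := fun i => HahnSeries.single (e i.toAdd) 1
      map_one' := by simp
      map_mul' := fun i j => by simp [HahnSeries.single_mul_single] }
    (fun r i => by
      simp [Commute, SemiconjBy, HahnSeries.C_apply, HahnSeries.single_mul_single])

/-- The inclusion `R[z,z⁻¹] ⊆ R((z))`. -/
def toPos : R[T;T⁻¹] →+* PosRing R :=
  laurentToSeries R (AddMonoidHom.id ℤ)

/-- The inclusion `R[z,z⁻¹] ⊆ R((z⁻¹))`. -/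
def toNeg : R[T;T⁻¹] →+* NegRing R :=
  laurentToSeries R { toFun := OrderDual.toDual, map_zero' := rfl, map_add' := fun _ _ => rfl }

end NovikovRings

section Complexes

variable {R : Type u} [Ring R]

/-- The cochain complex `C ⊗_{R[z,z⁻¹]} R((z))`, whose cohomology is the positive Novikov
cohomology of `C`. -/
def posComplex (C : CochainComplex (ModuleCat.{v} (R[T;T⁻¹])ᵐᵒᵖ) ℤ) :
    CochainComplex (ModuleCat.{max v u} (PosRing R)ᵐᵒᵖ) ℤ :=
  ((baseChange (toPos R)).mapHomologicalComplex _).obj C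

/-- The cochain complex `C ⊗_{R[z,z⁻¹]} R((z⁻¹))`, whose cohomology is the negative Novikov
cohomology of `C`. -/
def negComplex (C : CochainComplex (ModuleCat.{v} (R[T;T⁻¹])ᵐᵒᵖ) ℤ) :
    CochainComplex (ModuleCat.{max v u} (NegRing R)ᵐᵒᵖ) ℤ :=
  ((baseChange (toNeg R)).mapHomologicalComplex _).obj C

/-- A complex `C` of right `R[z,z⁻¹]`-modules, considered as a complex of right `R`-modules. -/
def underlyingComplex (C : CochainComplex (ModuleCat.{v} (R[T;T⁻¹])ᵐᵒᵖ) ℤ) :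
    CochainComplex (ModuleCat.{v} Rᵐᵒᵖ) ℤ :=
  ((ModuleCat.restrictScalars
    (RingHom.op (LaurentPolynomial.C (R := R)))).mapHomologicalComplex _).obj C

/-- `C` is finitely dominated: as a complex of right `R`-modules it is homotopy equivalent to a
bounded complex of finitely generated projective right `R`-modules. -/
def FinitelyDominated (C : CochainComplex (ModuleCat.{v} (R[T;T⁻¹])ᵐᵒᵖ) ℤ) : Prop :=
  ∃ B : CochainComplex (ModuleCat.{v} Rᵐᵒᵖ) ℤ,
    (∃ a b : ℤ, ∀ n : ℤ, n < a ∨ b < n → Limits.IsZero (B.X n)) ∧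
    (∀ n : ℤ, Module.Finite Rᵐᵒᵖ (B.X n) ∧ Module.Projective Rᵐᵒᵖ (B.X n)) ∧
    Nonempty (HomotopyEquiv (underlyingComplex C) B)

end Complexes

end Novikov

end

noncomputable section

namespace Novikov

section Lift

variable {A : Type u} {S : Type w} [Ring A] [Ring S] (f : A →+* S)
  {M : Type v} [AddCommGroup M] [Module Aᵐᵒᵖ M]

@[simp] lemma BaseChange.tmul_add (m : M) (s t : S) :
    BaseChange.tmul f m (s + t) = BaseChange.tmul f m s + BaseChange.tmul f m t := by
  simp [BaseChange.tmul, TensorProduct.add_tmul]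

@[simp] lemma BaseChange.add_tmul (m n : M) (s : S) :
    BaseChange.tmul f (m + n) s = BaseChange.tmul f m s + BaseChange.tmul f n s := by
  simp [BaseChange.tmul, TensorProduct.tmul_add]

@[simp] lemma BaseChange.zero_tmul (s : S) : BaseChange.tmul f (0 : M) s = 0 := by
  simp [BaseChange.tmul]

lemma BaseChange.sum_tmul {ι : Type*} (F : Finset ι) (m : ι → M) (s : S) :
    BaseChange.tmul f (∑ i ∈ F, m i) s = ∑ i ∈ F, BaseChange.tmul f (m i) s :=
  map_sum (AddMonoidHom.mk' (fun m => BaseChange.tmul f m s)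
    fun m n => BaseChange.add_tmul f m n s) m F

@[simp] lemma BaseChange.op_smul_tmul (m : M) (s t : S) :
    op t • BaseChange.tmul f m s = BaseChange.tmul f m (s * t) := rfl

lemma BaseChange.smul_tmul (a : A) (m : M) (s : S) :
    BaseChange.tmul f (op a • m) s = BaseChange.tmul f m (f a * s) := by
  symm
  rw [← sub_eq_zero]
  exact (Submodule.Quotient.mk_eq_zero _).2 (Submodule.subset_span ⟨a, s, m, rfl⟩)

lemma BaseChange.induction_on {p : BaseChange f M → Prop} (x : BaseChange f M)
    (tmul : ∀ m s, p (BaseChange.tmul f m s)) (add : ∀ x y, p x → p y → p (x + y)) : p x := by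
  obtain ⟨x, rfl⟩ := Submodule.mkQ_surjective _ x
  induction x using TensorProduct.induction_on with
  | zero => simpa using tmul 0 0
  | tmul s m => exact tmul m s
  | add x y hx hy => rw [map_add]; exact add _ _ hx hy

/-- The additive map on `M ⊗_A S` induced by a balanced biadditive map. -/
def BaseChange.lift {Q : Type*} [AddCommGroup Q] (φ : M →+ S →+ Q)
    (h : ∀ a m s, φ (op a • m) s = φ m (f a * s)) : BaseChange f M →+ Q :=
  QuotientAddGroup.lift (balancedRel f M).toAddSubgroup
    (TensorProduct.liftAddHom φ.flip fun r s m => by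
      simp only [AddMonoidHom.flip_apply, map_zsmul, AddMonoidHom.zsmul_apply]) (by
      let L : S ⊗[ℤ] M →+ Q := TensorProduct.liftAddHom φ.flip fun r s m => by
        simp only [AddMonoidHom.flip_apply, map_zsmul, AddMonoidHom.zsmul_apply]
      suffices H : ∀ x ∈ balancedRel f M, ∀ t : Sᵐᵒᵖ, L (t • x) = 0 by
        intro x hx
        simpa using H x hx 1
      intro x hx
      induction hx using Submodule.span_induction with
      | mem x hx =>
        obtain ⟨a, s, m, rfl⟩ := hx
        intro t
        simp [L, smul_sub, TensorProduct.smul_tmul', h, mul_assoc]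
      | zero => simp
      | add x y _ _ hx hy => intro t; rw [smul_add, map_add, hx, hy, add_zero]
      | smul a x _ hx => intro t; rw [smul_smul]; exact hx _)

@[simp] lemma BaseChange.lift_tmul {Q : Type*} [AddCommGroup Q] (φ : M →+ S →+ Q)
    (h : ∀ a m s, φ (op a • m) s = φ m (f a * s)) (m : M) (s : S) :
    BaseChange.lift f φ h (BaseChange.tmul f m s) = φ m s := rfl

variable (M S) in
/-- The pure tensor as a biadditive map. -/
def BaseChange.tmulHom : M →+ S →+ BaseChange f M :=
  AddMonoidHom.mk' (fun m => AddMonoidHom.mk' (BaseChange.tmul f m) (BaseChange.tmul_add f m))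
    fun m n => by ext s; exact BaseChange.add_tmul f m n s

@[simp] lemma BaseChange.tmulHom_apply (m : M) (s : S) :
    BaseChange.tmulHom S f M m s = BaseChange.tmul f m s := rfl

lemma BaseChange.map_comp {N P : Type v} [AddCommGroup N] [Module Aᵐᵒᵖ N]
    [AddCommGroup P] [Module Aᵐᵒᵖ P] (h : N →ₗ[Aᵐᵒᵖ] P) (g : M →ₗ[Aᵐᵒᵖ] N) (x : BaseChange f M) :
    BaseChange.map f (h ∘ₗ g) x = BaseChange.map f h (BaseChange.map f g x) := by
  induction x using BaseChange.induction_on with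
  | tmul m s => rfl
  | add x y hx hy => rw [map_add, hx, hy, map_add, map_add]

lemma BaseChange.map_add_apply {N : Type v} [AddCommGroup N] [Module Aᵐᵒᵖ N]
    (g h : M →ₗ[Aᵐᵒᵖ] N) (x : BaseChange f M) :
    BaseChange.map f (g + h) x = BaseChange.map f g x + BaseChange.map f h x := by
  induction x using BaseChange.induction_on with
  | tmul m s => simp
  | add x y hx hy => rw [map_add, hx, hy, map_add, map_add]; abel

lemma BaseChange.map_id_apply (x : BaseChange f M) :
    BaseChange.map f (LinearMap.id : M →ₗ[Aᵐᵒᵖ] M) x = x := by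
  induction x using BaseChange.induction_on with
  | tmul m s => rfl
  | add x y hx hy => rw [map_add, hx, hy]

lemma BaseChange.map_zero_apply {N : Type v} [AddCommGroup N] [Module Aᵐᵒᵖ N]
    (x : BaseChange f M) : BaseChange.map f (0 : M →ₗ[Aᵐᵒᵖ] N) x = 0 := by
  induction x using BaseChange.induction_on with
  | tmul m s => simp
  | add x y hx hy => rw [map_add, hx, hy, add_zero]

end Lift

section DiagramChase

/-- A diagram chase. The complex `Z` is a quotient of `X` by the image of an injective endomorphism
`φ`; the map `θ : X → Y` intertwines `φ` with an automorphism `Φ`, and it becomes an isomorphism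
`X' → Y'` after replacing `X` and `Y` by homotopy retracts. Then `Z` is exact. -/
lemma exact_of_homotopy_retract {X Y X' Y' Z : ℤ → Type*}
    [∀ n, AddCommGroup (X n)] [∀ n, AddCommGroup (Y n)] [∀ n, AddCommGroup (X' n)]
    [∀ n, AddCommGroup (Y' n)] [∀ n, AddCommGroup (Z n)]
    (dX : ∀ n, X n →+ X (n + 1)) (dY : ∀ n, Y n →+ Y (n + 1)) (dX' : ∀ n, X' n →+ X' (n + 1))
    (dY' : ∀ n, Y' n →+ Y' (n + 1)) (dZ : ∀ n, Z n →+ Z (n + 1))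
    (φ : ∀ n, X n →+ X n) (Φ : ∀ n, Y n →+ Y n) (θ : ∀ n, X n →+ Y n) (θ' : ∀ n, X' n →+ Y' n)
    (π : ∀ n, X n →+ Z n)
    (fX : ∀ n, X n →+ X' n) (gX : ∀ n, X' n →+ X n) (hX : ∀ n, X (n + 1) →+ X n)
    (fY : ∀ n, Y n →+ Y' n) (gY : ∀ n, Y' n →+ Y n) (hY : ∀ n, Y (n + 1) →+ Y n)
    (ddX : ∀ n x, dX (n + 1) (dX n x) = 0)
    (dφ : ∀ n x, dX n (φ n x) = φ (n + 1) (dX n x))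
    (dΦ : ∀ n x, dY n (Φ n x) = Φ (n + 1) (dY n x))
    (dθ : ∀ n x, dY n (θ n x) = θ (n + 1) (dX n x))
    (dθ' : ∀ n x, dY' n (θ' n x) = θ' (n + 1) (dX' n x))
    (dπ : ∀ n x, dZ n (π n x) = π (n + 1) (dX n x))
    (dgX : ∀ n x, dX n (gX n x) = gX (n + 1) (dX' n x))
    (dfY : ∀ n x, dY' n (fY n x) = fY (n + 1) (dY n x))
    (hhX : ∀ n x, gX (n + 1) (fX (n + 1) x) = hX (n + 1) (dX (n + 1) x) + dX n (hX n x) + x)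
    (hhY : ∀ n x, gY (n + 1) (fY (n + 1) x) = hY (n + 1) (dY (n + 1) x) + dY n (hY n x) + x)
    (θΦ : ∀ n x, θ n (φ n x) = Φ n (θ n x))
    (θf : ∀ n x, θ' n (fX n x) = fY n (θ n x))
    (θg : ∀ n x, θ n (gX n x) = gY n (θ' n x))
    (Φ_bij : ∀ n, Function.Bijective (Φ n)) (θ'_bij : ∀ n, Function.Bijective (θ' n))
    (φ_inj : ∀ n, Function.Injective (φ n)) (π_surj : ∀ n, Function.Surjective (π n))
    (φπ : ∀ n x, π n x = 0 ↔ ∃ y, φ n y = x)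
    (n : ℤ) (z : Z (n + 1)) (hz : dZ (n + 1) z = 0) : ∃ w, dZ n w = z := by
  have θ_inj (n : ℤ) (y : X (n + 1)) (hy : dX (n + 1) y = 0)
      (h : ∃ u, dY n u = θ (n + 1) y) : ∃ x, dX n x = y := by
    obtain ⟨u, hu⟩ := h
    obtain ⟨u', hu'⟩ := (θ'_bij n).2 (fY n u)
    have h1 : dX' n u' = fX (n + 1) y := (θ'_bij _).1 (by rw [← dθ', hu', dfY, hu, θf])
    refine ⟨gX n u' - hX n y, ?_⟩
    rw [map_sub, dgX, h1, hhX, hy, map_zero]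
    abel
  have θ_surj (n : ℤ) (u : Y (n + 1)) (hu : dY (n + 1) u = 0) :
      ∃ y v, dX (n + 1) y = 0 ∧ θ (n + 1) y = u + dY n v := by
    obtain ⟨y', hy'⟩ := (θ'_bij _).2 (fY (n + 1) u)
    have h1 : dX' (n + 1) y' = 0 := (θ'_bij _).1 (by rw [← dθ', hy', dfY, hu, map_zero, map_zero])
    refine ⟨gX _ y', hY n u, by rw [dgX, h1, map_zero], ?_⟩
    rw [θg, hy', hhY, hu, map_zero]
    abel
  obtain ⟨y, rfl⟩ := π_surj _ z
  rw [dπ, φπ] at hz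
  obtain ⟨w, hw⟩ := hz
  have hdw : dX (n + 1 + 1) w = 0 := φ_inj _ (by rw [← dφ, hw, ddX, map_zero])
  obtain ⟨v, rfl⟩ : ∃ v, dX (n + 1) v = w := by
    refine θ_inj _ _ hdw ?_
    obtain ⟨u, hu⟩ := (Φ_bij _).2 (θ _ y)
    exact ⟨u, (Φ_bij _).1 (by rw [← dΦ, hu, dθ, ← hw, θΦ])⟩
  obtain ⟨y', hy'⟩ : ∃ y', y' = y - φ _ v := ⟨_, rfl⟩
  have hdy : dX (n + 1) y' = 0 := by rw [hy', map_sub, dφ, hw, sub_self]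
  obtain ⟨u, hu⟩ := (Φ_bij _).2 (θ _ y')
  have hdu : dY (n + 1) u = 0 := (Φ_bij _).1 (by rw [← dΦ, hu, dθ, hdy, map_zero, map_zero])
  obtain ⟨t, s, ht, hts⟩ := θ_surj n u hdu
  obtain ⟨q, hq⟩ := θ_inj n (φ _ t - y') (by rw [map_sub, dφ, ht, hdy, map_zero, sub_zero])
    ⟨Φ n s, by rw [map_sub, θΦ, hts, map_add, hu, dΦ]; abel⟩
  refine ⟨π n (-q), ?_⟩
  have h0 (x) : π (n + 1) (φ (n + 1) x) = 0 := (φπ _ _).2 ⟨x, rfl⟩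
  rw [dπ, map_neg, hq, hy', neg_sub, map_sub, map_sub, h0, h0]
  simp

end DiagramChase

open LaurentPolynomial

section LaurentModules

/-- The right `R`-module structure on the right `R[z,z⁻¹]`-module `M` is the underlying one. -/
class IsUnderlying (R : Type u) [Ring R] (M : Type v) [AddCommGroup M] [Module (R[T;T⁻¹])ᵐᵒᵖ M]
    [Module Rᵐᵒᵖ M] : Prop where
  op_smul_eq : ∀ (r : R) (m : M), op r • m = op (LaurentPolynomial.C r) • m

variable {R : Type u} [Ring R] {M : Type v} [AddCommGroup M] [Module (R[T;T⁻¹])ᵐᵒᵖ M]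
  [Module Rᵐᵒᵖ M] [IsUnderlying R M]

variable (R M) in
/-- The action of `z ^ n` on a right `R[z,z⁻¹]`-module, as a map of right `R`-modules. -/
def zpowAct (n : ℤ) : M →ₗ[Rᵐᵒᵖ] M where
  toFun m := op (T n : R[T;T⁻¹]) • m
  map_add' := smul_add _
  map_smul' r m := by
    obtain ⟨r, rfl⟩ := op_surjective r
    rw [RingHom.id_apply, IsUnderlying.op_smul_eq r m, IsUnderlying.op_smul_eq r, smul_smul, smul_smul,
      ← op_mul, ← op_mul, (commute_T n (C r)).eq]

lemma zpowAct_apply (n : ℤ) (m : M) : zpowAct R M n m = op (T n : R[T;T⁻¹]) • m := rfl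

@[simp] lemma zpowAct_zpowAct (k n : ℤ) (m : M) :
    zpowAct R M k (zpowAct R M n m) = zpowAct R M (k + n) m := by
  rw [zpowAct_apply, zpowAct_apply, zpowAct_apply, smul_smul, ← op_mul, add_comm, T_add]

@[simp] lemma zpowAct_zero (m : M) : zpowAct R M 0 m = m := by
  rw [zpowAct_apply, T_zero, op_one, one_smul]

/-- Each element of a projective right `R[z,z⁻¹]`-module is the sum of finitely many `z ^ n`-multiples
of components that are `R`-linear in the element and compatible with the action of `z`. -/
lemma exists_homogeneous_components [Module.Projective (R[T;T⁻¹])ᵐᵒᵖ M] :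
    ∃ σ : ℤ → M →ₗ[Rᵐᵒᵖ] M, (∀ n m, σ (n + 1) (zpowAct R M 1 m) = σ n m) ∧
      ∀ m, ∀ᶠ F : Finset ℤ in Filter.atTop, ∑ n ∈ F, zpowAct R M n (σ n m) = m := by
  obtain ⟨s, hs⟩ := Module.projective_def'.1 ‹Module.Projective (R[T;T⁻¹])ᵐᵒᵖ M›
  let τ (n : ℤ) : (M →₀ (R[T;T⁻¹])ᵐᵒᵖ) →+ M := Finsupp.liftAddHom fun i =>
    AddMonoidHom.mk' (fun a => op ((unop a).coeff n) • i) fun a b => by simp [add_smul]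
  have τ_single (n i a) : τ n (.single i a) = op ((unop a).coeff n) • i := by simp [τ]
  have τ_smul (n : ℤ) (r : R) (y) : τ n (op (C r) • y) = op r • τ n y := by
    induction y using Finsupp.induction_linear with
    | zero => simp
    | add x y hx hy => simp only [smul_add, map_add, hx, hy]
    | single i a =>
      rw [Finsupp.smul_single, τ_single, τ_single, smul_smul, ← op_mul]
      congr 2
      exact (AddMonoidAlgebra.coeff_mul_single_apply (unop a) r 0 n).trans (by simp)
  have τ_T (n : ℤ) (y) : τ (n + 1) (op (T 1 : R[T;T⁻¹]) • y) = τ n y := by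
    induction y using Finsupp.induction_linear with
    | zero => simp
    | add x y hx hy => simp only [smul_add, map_add, hx, hy]
    | single i a =>
      rw [Finsupp.smul_single, τ_single, τ_single]
      congr 2
      exact (AddMonoidAlgebra.coeff_mul_single_apply (unop a) 1 1 (n + 1)).trans (by simp)
  have τ_sum (y) : ∀ᶠ F : Finset ℤ in Filter.atTop,
      ∑ n ∈ F, zpowAct R M n (τ n y) = Finsupp.linearCombination _ id y := by
    induction y using Finsupp.induction_linear with
    | zero => simp
    | add x y hx hy =>
      filter_upwards [hx, hy] with F h1 h2
      simp only [map_add, Finset.sum_add_distrib, h1, h2]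
    | single i a =>
      filter_upwards [Filter.eventually_ge_atTop (unop a).coeff.support] with F hF
      have ha : a = op (∑ n ∈ F, C ((unop a).coeff n) * T n) := by
        apply unop_injective
        refine LaurentPolynomial.ext fun k => ?_
        simp only [unop_op, ← single_eq_C_mul_T, AddMonoidAlgebra.coeff_sum,
          AddMonoidAlgebra.coeff_single, Finsupp.finsetSum_apply, Finsupp.single_apply]
        by_cases hk : k ∈ F
        · simp [hk]
        · have : (unop a).coeff k = 0 := by
            by_contra h
            exact hk (hF (Finsupp.mem_support_iff.2 h))
          simp [hk, this]
      rw [Finsupp.linearCombination_single, id]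
      conv_rhs => rw [ha, Finset.op_sum, Finset.sum_smul]
      refine Finset.sum_congr rfl fun n _ => ?_
      rw [τ_single, zpowAct_apply, IsUnderlying.op_smul_eq (_ : R) i, smul_smul, ← op_mul]
  refine ⟨fun n =>
    { toFun := fun m => τ n (s m)
      map_add' := by simp
      map_smul' := fun r m => ?_ }, fun n m => ?_, fun m => ?_⟩
  · obtain ⟨r, rfl⟩ := op_surjective r
    rw [RingHom.id_apply, IsUnderlying.op_smul_eq, map_smul, τ_smul]
  · exact (congrArg _ (map_smul s _ _)).trans (τ_T n _)
  · exact (τ_sum (s m)).mono fun F hF => hF.trans (LinearMap.congr_fun hs m)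

end LaurentModules

section Presentation

variable {R : Type u} [Ring R] {S : Type w} [Ring S] (c : R →+* S)
  {M : Type v} [AddCommGroup M] [Module (R[T;T⁻¹])ᵐᵒᵖ M] [Module Rᵐᵒᵖ M] [IsUnderlying R M]

variable (M) in
/-- For an element `z` of `S`, the endomorphism `m ⊗ s ↦ m z ⊗ s - m ⊗ s z` of `M ⊗_R S`. -/
def twist (z : S) : BaseChange c M →+ BaseChange c M :=
  (BaseChange.map c (zpowAct R M 1)).toAddMonoidHom - DistribSMul.toAddMonoidHom _ (op z)

lemma twist_apply (z : S) (x : BaseChange c M) :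
    twist c M z x = BaseChange.map c (zpowAct R M 1) x - op z • x := rfl

/-- If `z` is a unit of `S` and `M` is projective then `twist` is injective. -/
lemma twist_injective [Module.Projective (R[T;T⁻¹])ᵐᵒᵖ M] (z : Sˣ) :
    Function.Injective (twist c M (z : S)) := by
  rw [injective_iff_map_eq_zero]
  intro x hx
  rw [twist_apply, sub_eq_zero] at hx
  obtain ⟨σ, hσ, hσ_sum⟩ := exists_homogeneous_components (R := R) (M := M)
  have step (n : ℤ) : BaseChange.map c (σ n) x = op (z : S) • BaseChange.map c (σ (n + 1)) x := by
    rw [← map_smul, ← hx, ← BaseChange.map_comp]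
    congr 2
    exact LinearMap.ext fun m => (hσ n m).symm
  have sum_eq (y : BaseChange c M) : ∀ᶠ F : Finset ℤ in Filter.atTop,
      ∑ n ∈ F, BaseChange.map c (zpowAct R M n) (BaseChange.map c (σ n) y) = y := by
    induction y using BaseChange.induction_on with
    | tmul m s =>
      filter_upwards [hσ_sum m] with F hF
      simp only [BaseChange.map_tmul, ← BaseChange.sum_tmul, hF]
    | add x y hx hy =>
      filter_upwards [hx, hy] with F h1 h2
      simp only [map_add, Finset.sum_add_distrib, h1, h2]
  obtain ⟨F, hF⟩ := Filter.eventually_atTop.1 (sum_eq x)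
  obtain ⟨n₀, hn₀⟩ := Infinite.exists_notMem_finset F
  have zero₀ : BaseChange.map c (σ n₀) x = 0 := by
    have h := hF (insert n₀ F) (Finset.subset_insert _ _)
    rw [Finset.sum_insert hn₀, hF F le_rfl, add_eq_right] at h
    have h' := congrArg (BaseChange.map c (zpowAct R M (-n₀))) h
    rw [← BaseChange.map_comp, map_zero] at h'
    rw [← h']
    conv_lhs => rw [← BaseChange.map_id_apply c (BaseChange.map c (σ n₀) x)]
    congr 2
    exact LinearMap.ext fun m => by simp
  have zero (n : ℤ) : BaseChange.map c (σ n) x = 0 := by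
    induction n using Int.inductionOn' (b := n₀) with
    | zero => exact zero₀
    | succ k _ ih =>
      rw [step] at ih
      simpa [smul_smul, ← op_mul] using congrArg (op (↑z⁻¹ : S) • ·) ih
    | pred k _ ih => rw [step, sub_add_cancel, ih, smul_zero]
  rw [← hF F le_rfl]
  simp [zero]

variable (g : R[T;T⁻¹] →+* S) (hg : ∀ r, g (C r) = c r)

variable (M) in
/-- The projection `M ⊗_R S → M ⊗_{R[z,z⁻¹]} S`. -/
def toLaurentBaseChange : BaseChange c M →+ BaseChange g M :=
  BaseChange.lift c (BaseChange.tmulHom S g M) fun r m s => by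
    simp [IsUnderlying.op_smul_eq, BaseChange.smul_tmul, hg]

@[simp] lemma toLaurentBaseChange_tmul (m : M) (s : S) :
    toLaurentBaseChange c M g hg (BaseChange.tmul c m s) = BaseChange.tmul g m s := rfl

lemma toLaurentBaseChange_surjective : Function.Surjective (toLaurentBaseChange c M g hg) := by
  intro x
  induction x using BaseChange.induction_on with
  | tmul m s => exact ⟨BaseChange.tmul c m s, rfl⟩
  | add x y hx hy =>
    obtain ⟨x, rfl⟩ := hx
    obtain ⟨y, rfl⟩ := hy
    exact ⟨x + y, map_add _ _ _⟩

/-- The kernel of `M ⊗_R S → M ⊗_{R[z,z⁻¹]} S` is the image of `twist`. -/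
lemma toLaurentBaseChange_eq_zero_iff (hz : ∀ s, Commute (g (T 1)) s) (x : BaseChange c M) :
    toLaurentBaseChange c M g hg x = 0 ↔ ∃ y, twist c M (g (T 1)) y = x := by
  constructor
  · intro hx
    let q := QuotientAddGroup.mk' (twist c M (g (T 1))).range
    have q_one (m : M) (s : S) : q (BaseChange.tmul c (zpowAct R M 1 m) s) =
        q (BaseChange.tmul c m (g (T 1) * s)) := by
      rw [← sub_eq_zero, ← map_sub]
      refine (QuotientAddGroup.eq_zero_iff _).2 ⟨BaseChange.tmul c m s, ?_⟩
      rw [twist_apply, BaseChange.op_smul_tmul, (hz s).eq, BaseChange.map_tmul]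
    have q_zpow (n : ℤ) : ∀ (m : M) (s : S), q (BaseChange.tmul c (zpowAct R M n m) s) =
        q (BaseChange.tmul c m (g (T n) * s)) := by
      induction n using Int.induction_on with
      | zero => simp
      | succ n ih =>
        intro m s
        rw [← zpowAct_zpowAct, ih, q_one, T_add, map_mul, (hz _).eq.symm, mul_assoc]
      | pred n ih =>
        intro m s
        have h := q_one (zpowAct R M (-n - 1) m) (g (T (-1)) * s)
        rw [zpowAct_zpowAct, ← mul_assoc, ← map_mul, ← T_add, add_neg_cancel, T_zero, map_one,
          one_mul, add_sub_cancel, ih, ← mul_assoc, ← map_mul, ← T_add] at h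
        exact h.symm
    let l : BaseChange g M →+ BaseChange c M ⧸ (twist c M (g (T 1))).range :=
      BaseChange.lift g ((AddMonoidHom.compHom q).comp (BaseChange.tmulHom S c M)) fun a m s => by
        change q (BaseChange.tmul c (op a • m) s) = q (BaseChange.tmul c m (g a * s))
        induction a using LaurentPolynomial.induction_on' with
        | add a b ha hb =>
          rw [MulOpposite.op_add, add_smul, BaseChange.add_tmul, map_add, ha, hb, map_add g, add_mul,
            BaseChange.tmul_add, map_add]
        | C_mul_T n r =>
          rw [op_mul, mul_smul, ← IsUnderlying.op_smul_eq, ← zpowAct_apply, q_zpow,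
            BaseChange.smul_tmul, map_mul, hg, mul_assoc]
    have hl (x) : l (toLaurentBaseChange c M g hg x) = q x := by
      induction x using BaseChange.induction_on with
      | tmul m s => rfl
      | add x y hx hy => rw [map_add, map_add, hx, hy, map_add]
    have := hl x
    rw [hx, map_zero, eq_comm] at this
    exact (QuotientAddGroup.eq_zero_iff _).1 this
  · rintro ⟨y, rfl⟩
    induction y using BaseChange.induction_on with
    | tmul m s =>
      rw [twist_apply, BaseChange.map_tmul, BaseChange.op_smul_tmul, map_sub,
        toLaurentBaseChange_tmul, toLaurentBaseChange_tmul, ← (hz s).eq, zpowAct_apply,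
        BaseChange.smul_tmul, sub_self]
    | add x y hx hy => rw [map_add, map_add, hx, hy, add_zero]

end Presentation

section HahnSeriesCoefficients

variable {R : Type u} [Ring R] {Γ : Type} [AddCommGroup Γ] [LinearOrder Γ] [IsOrderedAddMonoid Γ]

variable (Γ) in
/-- The map on formal series induced by an additive map on coefficients. -/
def seriesMap {M N : Type*} [AddCommGroup M] [AddCommGroup N] (g : M →+ N) :
    HahnSeries Γ M →+ HahnSeries Γ N :=
  AddMonoidHom.mk' (fun x => x.map g) fun x y => by ext; simp

omit [AddCommGroup Γ] [IsOrderedAddMonoid Γ] in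
@[simp] lemma seriesMap_coeff {M N : Type*} [AddCommGroup M] [AddCommGroup N] (g : M →+ N)
    (x : HahnSeries Γ M) (γ : Γ) : (seriesMap Γ g x).coeff γ = g (x.coeff γ) := rfl

variable (R Γ) in
/-- The natural map from `M ⊗_R S` to the formal series with coefficients in `M`, for `S` the ring
of formal series with coefficients in `R`. -/
def toSeries (M : Type v) [AddCommGroup M] [Module Rᵐᵒᵖ M] :
    BaseChange (HahnSeries.C : R →+* HahnSeries Γ R) M →+ HahnSeries Γ M :=
  BaseChange.lift _
    (AddMonoidHom.mk' (fun m => seriesMap Γ (AddMonoidHom.mk' (fun r : R => op r • m)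
      fun r s => by rw [MulOpposite.op_add, add_smul])) fun m n => by ext; simp)
    fun r m s => by
      ext γ
      simp [HahnSeries.C_apply, smul_smul]

@[simp] lemma toSeries_tmul_coeff {M : Type v} [AddCommGroup M] [Module Rᵐᵒᵖ M] (m : M)
    (s : HahnSeries Γ R) (γ : Γ) :
    (toSeries R Γ M (BaseChange.tmul _ m s)).coeff γ = op (s.coeff γ) • m := rfl

lemma toSeries_map {M N : Type v} [AddCommGroup M] [Module Rᵐᵒᵖ M] [AddCommGroup N]
    [Module Rᵐᵒᵖ N] (g : M →ₗ[Rᵐᵒᵖ] N) (x) :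
    toSeries R Γ N (BaseChange.map _ g x) = seriesMap Γ g.toAddMonoidHom (toSeries R Γ M x) := by
  induction x using BaseChange.induction_on with
  | tmul m s => ext γ; simp
  | add x y hx hy => simp only [map_add, hx, hy]

/-- For finitely generated projective `M`, every formal series with coefficients in `M` comes from
a unique element of `M ⊗_R S`. -/
lemma toSeries_bijective (M : Type v) [AddCommGroup M] [Module Rᵐᵒᵖ M] [Module.Finite Rᵐᵒᵖ M]
    [Module.Projective Rᵐᵒᵖ M] : Function.Bijective (toSeries R Γ M) := by
  obtain ⟨n, p, i, -, -, hpi⟩ := Module.Finite.exists_comp_eq_id_of_projective Rᵐᵒᵖ M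
  let l (j : Fin n) : M →+ R :=
    AddMonoidHom.mk' (fun m => unop (i m j)) fun _ _ => by simp
  let b (j : Fin n) : M := p (Pi.single j 1)
  have hb (m : M) : ∑ j, op (l j m) • b j = m := by
    refine .trans ?_ (LinearMap.congr_fun hpi m)
    conv_rhs => rw [LinearMap.comp_apply, pi_eq_sum_univ' (i m), map_sum]
    refine Finset.sum_congr rfl fun j _ => ?_
    rw [map_smul]
    congr 2
  have hl (j : Fin n) (r : R) (m : M) : l j (op r • m) = l j m * r := by simp [l]
  let inv (u : HahnSeries Γ M) : BaseChange (HahnSeries.C : R →+* HahnSeries Γ R) M :=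
    ∑ j, BaseChange.tmul _ (b j) (seriesMap Γ (l j) u)
  have inv_add (u v) : inv (u + v) = inv u + inv v := by
    simp only [inv, map_add, BaseChange.tmul_add, Finset.sum_add_distrib]
  refine Function.bijective_iff_has_inverse.2 ⟨inv, fun x => ?_, fun u => ?_⟩
  · induction x using BaseChange.induction_on with
    | tmul m s =>
      conv_rhs => rw [← hb m, BaseChange.sum_tmul]
      refine Finset.sum_congr rfl fun j _ => ?_
      rw [BaseChange.smul_tmul]
      congr 1
      ext γ
      simp [HahnSeries.C_apply, hl]
    | add x y hx hy => rw [map_add, inv_add, hx, hy]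
  · simp only [inv, map_sum]
    ext γ
    rw [HahnSeries.coeff_sum]
    exact hb (u.coeff γ)

lemma isUnit_C_sub_single {K : Type*} [CommRing K] (a : Kˣ) {ε : Γ} (hε : ε ≠ 0) :
    IsUnit (HahnSeries.C (a : K) - HahnSeries.single ε 1) := by
  have key (b : K) {δ : Γ} (hδ : 0 < δ) : IsUnit (1 - HahnSeries.single δ b) := by
    apply HahnSeries.isUnit_of_orderTop_pos
    rw [sub_sub_cancel_left, HahnSeries.orderTop_neg]
    exact (WithTop.coe_lt_coe.2 hδ).trans_le HahnSeries.orderTop_single_le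
  have mono (b : Kˣ) (δ : Γ) : IsUnit (HahnSeries.single δ (b : K)) :=
    .of_mul_eq_one (HahnSeries.single (-δ) (↑b⁻¹ : K)) (by simp [HahnSeries.single_mul_single])
  obtain h | h := hε.lt_or_gt
  · convert ((mono 1 ε).neg).mul (key a (neg_pos.2 h)) using 1
    simp [mul_sub, HahnSeries.single_mul_single, HahnSeries.C_apply]
    abel
  · convert (mono a 0).mul (key (↑a⁻¹) h) using 1
    simp [mul_sub, HahnSeries.single_mul_single, HahnSeries.C_apply]

variable {M : Type v} [AddCommGroup M] [Module (R[T;T⁻¹])ᵐᵒᵖ M] [Module Rᵐᵒᵖ M] [IsUnderlying R M]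

/-- Multiplication of formal series by the monomial of exponent `ε`. -/
def seriesShift (Γ : Type) [AddCommGroup Γ] [LinearOrder Γ] [IsOrderedAddMonoid Γ]
    (M : Type*) [AddCommGroup M] (ε : Γ) : HahnSeries Γ M →+ HahnSeries Γ M :=
  AddMonoidHom.mk' (fun x => (HahnModule.of ℤ).symm
    (HahnSeries.single ε (1 : ℤ) • HahnModule.of ℤ x)) fun x y => by simp

@[simp] lemma seriesShift_coeff {M : Type*} [AddCommGroup M] (ε : Γ) (x : HahnSeries Γ M) (γ : Γ) :
    (seriesShift Γ M ε x).coeff γ = x.coeff (γ - ε) := by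
  have := HahnModule.coeff_single_smul_vadd (r := (1 : ℤ)) (x := HahnModule.of ℤ x) (a := γ - ε)
    (b := ε)
  rw [vadd_eq_add, add_sub_cancel, one_smul] at this
  exact this

variable (R M) in
/-- The endomorphism `ζ - z` of the formal series with coefficients in `M`, where `ζ` is the action
of the indeterminate on coefficients and `z` is the monomial of exponent `ε`. -/
def seriesTwist (ε : Γ) : HahnSeries Γ M →+ HahnSeries Γ M :=
  seriesMap Γ (zpowAct R M 1).toAddMonoidHom - seriesShift Γ M ε

lemma seriesTwist_coeff (ε : Γ) (x : HahnSeries Γ M) (γ : Γ) :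
    (seriesTwist R M ε x).coeff γ = zpowAct R M 1 (x.coeff γ) - x.coeff (γ - ε) := by
  rw [seriesTwist, AddMonoidHom.sub_apply, HahnSeries.coeff_sub, seriesShift_coeff]
  rfl

lemma seriesTwist_bijective {ε : Γ} (hε : ε ≠ 0) : Function.Bijective (seriesTwist R M ε) := by
  let K := Subring.center (R[T;T⁻¹])ᵐᵒᵖ
  have mem (n : ℤ) : op (T n : R[T;T⁻¹]) ∈ K := Subring.mem_center_iff.2 fun a =>
    unop_injective (commute_T n (unop a)).eq
  have mul {m n : ℤ} (h : n + m = 0) : op (T m : R[T;T⁻¹]) * op (T n) = 1 := by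
    rw [← op_mul, ← T_add, h, T_zero, op_one]
  let ζ : Kˣ := ⟨⟨_, mem 1⟩, ⟨_, mem (-1)⟩, Subtype.ext (mul (neg_add_cancel 1)),
    Subtype.ext (mul (add_neg_cancel 1))⟩
  obtain ⟨t, ht⟩ := isUnit_C_sub_single ζ hε
  have h (x : HahnSeries Γ M) :
      seriesTwist R M ε x = (HahnModule.of K).symm (t • HahnModule.of K x) := by
    ext γ
    have h1 := HahnModule.coeff_single_smul_vadd (r := (1 : K)) (x := HahnModule.of K x)
      (a := γ - ε) (b := ε)
    rw [vadd_eq_add, add_sub_cancel, one_smul] at h1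
    rw [seriesTwist_coeff, Units.smul_def, ht, sub_smul, HahnModule.of_symm_sub,
      HahnSeries.coeff_sub, h1, HahnSeries.C_apply, HahnModule.coeff_single_zero_smul]
    rfl
  have : (seriesTwist R M ε : HahnSeries Γ M → HahnSeries Γ M) =
      (HahnModule.of K).symm ∘ (t • ·) ∘ HahnModule.of K := funext h
  rw [this]
  exact (HahnModule.of K).symm.bijective.comp
    ((MulAction.bijective t).comp (HahnModule.of K).bijective)

lemma toSeries_twist (ε : Γ) (x) :
    toSeries R Γ M (twist HahnSeries.C M (HahnSeries.single ε 1) x) =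
      seriesTwist R M ε (toSeries R Γ M x) := by
  induction x using BaseChange.induction_on with
  | tmul m s =>
    ext γ
    rw [seriesTwist_coeff, twist_apply, BaseChange.map_tmul, BaseChange.op_smul_tmul, map_sub,
      HahnSeries.coeff_sub, toSeries_tmul_coeff, toSeries_tmul_coeff, toSeries_tmul_coeff,
      toSeries_tmul_coeff, map_smul, HahnSeries.coeff_mul_single, mul_one]
  | add x y hx hy => simp only [map_add, hx, hy]

end HahnSeriesCoefficients

section Acyclicity

variable {R : Type u} [Ring R] {Γ : Type} [AddCommGroup Γ] [LinearOrder Γ] [IsOrderedAddMonoid Γ]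

lemma laurentToSeries_C (e : ℤ →+ Γ) (r : R) :
    laurentToSeries R e (LaurentPolynomial.C r) = HahnSeries.C r := by
  refine (AddMonoidAlgebra.liftNCRingHom_single _ _ _ _ _).trans ?_
  simp

lemma laurentToSeries_T (e : ℤ →+ Γ) (n : ℤ) :
    laurentToSeries R e (T n) = HahnSeries.single (e n) 1 := by
  refine (AddMonoidAlgebra.liftNCRingHom_single _ _ _ _ _).trans ?_
  simp

lemma commute_single_one (γ : Γ) (s : HahnSeries Γ R) :
    Commute (HahnSeries.single γ 1) s := by
  ext δ
  rw [HahnSeries.coeff_single_mul, HahnSeries.coeff_mul_single, one_mul, mul_one]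

/-- The complex of right `R`-modules underlying `C` consists of right `R[z,z⁻¹]`-modules. -/
instance (C : CochainComplex (ModuleCat.{v} (R[T;T⁻¹])ᵐᵒᵖ) ℤ) (n : ℤ) :
    Module (R[T;T⁻¹])ᵐᵒᵖ ((underlyingComplex C).X n) :=
  inferInstanceAs (Module (R[T;T⁻¹])ᵐᵒᵖ (C.X n))

instance (C : CochainComplex (ModuleCat.{v} (R[T;T⁻¹])ᵐᵒᵖ) ℤ) (n : ℤ) :
    IsUnderlying R ((underlyingComplex C).X n) where
  op_smul_eq _ _ := rfl

/-- The differential of `C` as a map of the underlying `R[z,z⁻¹]`-modules. -/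
def laurentDifferential (C : CochainComplex (ModuleCat.{v} (R[T;T⁻¹])ᵐᵒᵖ) ℤ) (i j : ℤ) :
    (underlyingComplex C).X i →ₗ[(R[T;T⁻¹])ᵐᵒᵖ] (underlyingComplex C).X j :=
  (C.d i j).hom

lemma d_comp_zpowAct (C : CochainComplex (ModuleCat.{v} (R[T;T⁻¹])ᵐᵒᵖ) ℤ) (i j n : ℤ)
    (x : (underlyingComplex C).X i) : ((underlyingComplex C).d i j).hom (zpowAct R _ n x) =
      zpowAct R _ n (((underlyingComplex C).d i j).hom x) :=
  map_smul (laurentDifferential C i j) _ _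

lemma hom_f_comm_apply {K L : CochainComplex (ModuleCat.{v} Rᵐᵒᵖ) ℤ} (f : K ⟶ L) (i j : ℤ) :
    (L.d i j).hom ∘ₗ (f.f i).hom = (f.f j).hom ∘ₗ (K.d i j).hom :=
  congrArg ModuleCat.Hom.hom (f.comm i j)

lemma homotopy_succ {K : CochainComplex (ModuleCat.{v} Rᵐᵒᵖ) ℤ} {f : K ⟶ K}
    (h : Homotopy f (𝟙 K)) (n : ℤ) :
    (f.f (n + 1)).hom = (h.hom (n + 1 + 1) (n + 1)).hom ∘ₗ (K.d (n + 1) (n + 1 + 1)).hom +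
      (K.d n (n + 1)).hom ∘ₗ (h.hom (n + 1) n).hom + LinearMap.id := by
  have := h.comm (n + 1)
  rw [dNext_eq h.hom (show (ComplexShape.up ℤ).Rel (n + 1) (n + 1 + 1) from rfl),
    prevD_eq h.hom (show (ComplexShape.up ℤ).Rel n (n + 1) from rfl)] at this
  exact congrArg ModuleCat.Hom.hom this

/-- Base change of a finitely dominated complex of projective modules to a ring of formal series
in which the indeterminate becomes a monomial of non-zero exponent is acyclic. -/
theorem acyclic_baseChange_laurentToSeries (e : ℤ →+ Γ) (he : e 1 ≠ 0)
    (C : CochainComplex (ModuleCat.{v} (R[T;T⁻¹])ᵐᵒᵖ) ℤ)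
    (hC : ∀ n : ℤ, Module.Projective (R[T;T⁻¹])ᵐᵒᵖ (C.X n)) (hfd : FinitelyDominated C) :
    (((baseChange (laurentToSeries R e)).mapHomologicalComplex _).obj C).Acyclic := by
  obtain ⟨B, -, hB, ⟨H⟩⟩ := hfd
  have (n : ℤ) : Module.Finite Rᵐᵒᵖ (B.X n) := (hB n).1
  have (n : ℤ) : Module.Projective Rᵐᵒᵖ (B.X n) := (hB n).2
  have (n : ℤ) : Module.Projective (R[T;T⁻¹])ᵐᵒᵖ ((underlyingComplex C).X n) := hC n
  let c : R →+* HahnSeries Γ R := HahnSeries.C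
  let z : (HahnSeries Γ R)ˣ := ⟨HahnSeries.single (e 1) 1, HahnSeries.single (-e 1) 1,
    by simp [HahnSeries.single_mul_single], by simp [HahnSeries.single_mul_single]⟩
  let K := underlyingComplex C
  let h := homotopy_succ H.homotopyHomInvId
  have hz : laurentToSeries R e (T 1) = z := laurentToSeries_T e 1
  intro n
  obtain ⟨n, rfl⟩ : ∃ k, n = k + 1 := ⟨n - 1, by ring⟩
  rw [HomologicalComplex.exactAt_iff' _ n (n + 1) (n + 1 + 1) (by simp) (by simp),
    ShortComplex.moduleCat_exact_iff]
  exact exact_of_homotopy_retract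
    (X := fun n => BaseChange c (K.X n)) (Y := fun n => HahnSeries Γ (K.X n))
    (X' := fun n => BaseChange c (B.X n)) (Y' := fun n => HahnSeries Γ (B.X n))
    (Z := fun n => BaseChange (laurentToSeries R e) (K.X n))
    (fun n => (BaseChange.map c (K.d n (n + 1)).hom).toAddMonoidHom)
    (fun n => seriesMap Γ (K.d n (n + 1)).hom.toAddMonoidHom)
    (fun n => (BaseChange.map c (B.d n (n + 1)).hom).toAddMonoidHom)
    (fun n => seriesMap Γ (B.d n (n + 1)).hom.toAddMonoidHom)
    (fun n => (BaseChange.map _ (laurentDifferential C n (n + 1))).toAddMonoidHom)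
    (fun n => twist c (K.X n) (z : HahnSeries Γ R))
    (fun n => seriesTwist R (K.X n) (e 1))
    (fun n => toSeries R Γ (K.X n)) (fun n => toSeries R Γ (B.X n))
    (fun n => toLaurentBaseChange c (K.X n) _ (laurentToSeries_C e))
    (fun n => (BaseChange.map c (H.hom.f n).hom).toAddMonoidHom)
    (fun n => (BaseChange.map c (H.inv.f n).hom).toAddMonoidHom)
    (fun n => (BaseChange.map c (H.homotopyHomInvId.hom (n + 1) n).hom).toAddMonoidHom)
    (fun n => seriesMap Γ (H.hom.f n).hom.toAddMonoidHom)
    (fun n => seriesMap Γ (H.inv.f n).hom.toAddMonoidHom)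
    (fun n => seriesMap Γ (H.homotopyHomInvId.hom (n + 1) n).hom.toAddMonoidHom)
    (ddX := fun n x => by
      refine (BaseChange.map_comp c _ _ x).symm.trans ?_
      rw [← ModuleCat.hom_comp, K.d_comp_d]
      exact BaseChange.map_zero_apply c x)
    (dφ := fun n x => by
      change BaseChange.map c _ (twist c _ _ x) = twist c _ _ (BaseChange.map c _ x)
      rw [twist_apply, twist_apply, map_sub, map_smul, ← BaseChange.map_comp,
        ← BaseChange.map_comp]
      congr 3
      exact LinearMap.ext fun m => d_comp_zpowAct C _ _ _ m)
    (dΦ := fun n x => by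
      ext γ
      rw [seriesTwist_coeff, seriesMap_coeff, seriesTwist_coeff, map_sub]
      exact congrArg (· - _) (d_comp_zpowAct C _ _ _ _))
    (dθ := fun n x => (toSeries_map _ x).symm)
    (dθ' := fun n x => (toSeries_map _ x).symm)
    (dπ := fun n x => by
      change BaseChange.map _ _ (toLaurentBaseChange c _ _ _ x) =
        toLaurentBaseChange c _ _ _ (BaseChange.map c _ x)
      induction x using BaseChange.induction_on with
      | tmul m s => rfl
      | add x y hx hy => simp only [map_add, hx, hy])
    (dgX := fun n x => by
      change BaseChange.map c _ (BaseChange.map c _ x) = BaseChange.map c _ (BaseChange.map c _ x)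
      rw [← BaseChange.map_comp, ← BaseChange.map_comp, hom_f_comm_apply])
    (dfY := fun n x => by
      ext γ
      exact LinearMap.congr_fun (hom_f_comm_apply H.hom n (n + 1)) (x.coeff γ))
    (hhX := fun n x => by
      refine (BaseChange.map_comp c _ _ x).symm.trans
        ((congrArg (fun g => BaseChange.map c g x) (h n)).trans ?_)
      rw [BaseChange.map_add_apply, BaseChange.map_add_apply, BaseChange.map_comp,
        BaseChange.map_comp, BaseChange.map_id_apply]
      rfl)
    (hhY := fun n x => by
      ext γ
      exact LinearMap.congr_fun (h n) (x.coeff γ))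
    (θΦ := fun n x => toSeries_twist _ x)
    (θf := fun n x => toSeries_map _ x)
    (θg := fun n x => toSeries_map _ x)
    (Φ_bij := fun n => seriesTwist_bijective he)
    (θ'_bij := fun n => toSeries_bijective _)
    (φ_inj := fun n => twist_injective c z)
    (π_surj := fun n => toLaurentBaseChange_surjective c _ _)
    (φπ := fun n x => by
      rw [← hz]
      exact toLaurentBaseChange_eq_zero_iff c _ _
        (fun s => by rw [laurentToSeries_T]; exact commute_single_one _ s) x)
    n

end Acyclicity

end Novikov

end

theorem mainTheorem2 {R : Type u} [Ring R]
    (C : CochainComplex (ModuleCat.{v} (R[T;T⁻¹])ᵐᵒᵖ) ℤ)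
    (hC_bdd : ∃ b : ℤ, ∀ n : ℤ, b < n → CategoryTheory.Limits.IsZero (C.X n))
    (hC_proj : ∀ n : ℤ, Module.Projective (R[T;T⁻¹])ᵐᵒᵖ (C.X n))
    (hC_fd : Novikov.FinitelyDominated C) :
    (Novikov.posComplex C).Acyclic ∧ (Novikov.negComplex C).Acyclic :=
  ⟨Novikov.acyclic_baseChange_laurentToSeries (AddMonoidHom.id ℤ) one_ne_zero C hC_proj hC_fd,
    Novikov.acyclic_baseChange_laurentToSeries
      { toFun := OrderDual.toDual, map_zero' := rfl, map_add' := fun _ _ => rfl }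
      (one_ne_zero : (1 : ℤ) ≠ 0) C hC_proj hC_fd⟩
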